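/- Fix a set of propositional variables (for instance a countably infinite one) and consider formulas built from the variables with the binary connectives $\to,\&,\vee,\wedge$ and the constants $\mathtt t,\mathtt f$; write $-\varphi := \varphi\to\mathtt t$. Pointed Abelian logic $\mathrm{pAb}$ is the logic in this language presented by all instances of the axiom schemata $(\varphi\to\psi)\to((\psi\to\xi)\to(\varphi\to\xi))$; $(\varphi\to(\psi\to\xi))\to(\psi\to(\varphi\to\xi))$; $\varphi\to\varphi$; $((\varphi\to\psi)\to\psi)\to\varphi$; $\varphi\to(\varphi\vee\psi)$; $\psi\to(\varphi\vee\psi)$; $(\varphi\wedge\psi)\to\varphi$; $(\varphi\wedge\psi)\to\psi$; $((\varphi\to\chi)\wedge(\psi\to\chi))\to((\varphi\vee\psi)\to\chi)$; $((\chi\to\varphi)\wedge(\chi\to\psi))\to(\chi\to(\varphi\wedge\psi))$; $\varphi\to(\mathtt t\to\varphi)$; $(\mathtt t\to\varphi)\to\varphi$; $(\varphi\to(\psi\to\xi))\to((\varphi\mathbin{\&}\psi)\to\xi)$; $((\varphi\mathbin{\&}\psi)\to\xi)\to(\varphi\to(\psi\to\xi))$; and of the rules modus ponens, $\varphi,\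 \varphi\to\psi\vdash\psi$, and adjunction, $\varphi,\ \psi\vdash\varphi\wedge\psi$. Łukasiewicz unbound logic $\mathrm{Lu}$ is the extension of $\mathrm{pAb}$ by all instances of the rule $\mathtt f\vee\varphi\vdash\varphi$, and $\mathrm{Lu}^*$ is the extension of $\mathrm{pAb}$ by all instances of the rule $-\mathtt f\vee\varphi\vdash\varphi$. For a logic $L$, $\Gamma\vdash_L\varphi$ means that $\varphi$ is provable from premises in $\Gamma$ by the axioms and rules of $L$. Let $\tau$ be the map from formulas to formulas defined recursively by $\tau(\mathtt f)=-\mathtt f$ (that is, $\mathtt f\to\mathtt t$), $\tau(\mathtt t)=\mathtt t$, $\tau(x)=x$ for every variable $x$, and $\tau(\psi\circ\xi)=\tau(\psi)\circ\tau(\xi)$ for every binary connective $\circ\in\{\to,\&,\vee,\wedge\}$; write $\tau[\Gamma]=\{\tau(\gamma):\gamma\in\Gamma\}$. Then for every (finite or infinite) set of formulas $\Gamma$ and every formula $\varphi$: 1. $\Gamma\vdash_{\mathrm{Lu}}\varphi$ if and only if $\tau[\Gamma]\vdash_{\mathrm{Lu}^*}\tau(\varphi)$; 2. $\Gamma\vdash_{\mathrm{Lu}^*}\varphi$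 if and only if $\tau[\Gamma]\vdash_{\mathrm{Lu}}\tau(\varphi)$. -/

import Mathlib

namespace PointedAbelian

/-- Formulas of the language of pointed Abelian logic (binary connectives `→, &, ∨, ∧`, constants
`t, f`) over a set `V` of propositional variables. -/
inductive Fm (V : Type*) where
  | var : V → Fm V
  | imp : Fm V → Fm V → Fm V
  | conj : Fm V → Fm V → Fm V
  | or : Fm V → Fm V → Fm V
  | and : Fm V → Fm V → Fm V
  | t : Fm V
  | f : Fm V

infixr:60 " ⟶ₗ " => Fm.imp
infixl:70 " &ₗ " => Fm.conj
infixl:65 " ∨ₗ " => Fm.or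
infixl:68 " ∧ₗ " => Fm.and

/-- The defined connective `-φ := φ → t`. -/
def Fm.neg {V : Type*} (φ : Fm V) : Fm V := φ ⟶ₗ Fm.t

/-- A consecution: a set of premises (possibly infinite) together with a conclusion. -/
abbrev Consecution (V : Type*) := Set (Fm V) × Fm V

/-- `TreeProvable AS Γ φ`: there is a well-founded proof tree for `φ` whose leaves are elements
of `Γ` or conclusions of premise-free members of `AS`, and whose inner nodes are applications of
members of `AS`. -/
inductive TreeProvable {V : Type*} (AS : Set (Consecution V)) (Γ : Set (Fm V)) : Fm V → Prop
  | premise (φ : Fm V) : φ ∈ Γ → TreeProvable AS Γ φ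
  | rule (Δ : Set (Fm V)) (φ : Fm V) :
      (Δ, φ) ∈ AS → (∀ δ ∈ Δ, TreeProvable AS Γ δ) → TreeProvable AS Γ φ

/-- The logic given by a set of rules: all consecutions that are tree-provable in it. -/
def logicOf {V : Type*} (AS : Set (Consecution V)) : Set (Consecution V) :=
  {c | TreeProvable AS c.1 c.2}

/-- All instances, in the language with the constant `f`, of the schemata that present Abelian
logic. -/
inductive PAbRule {V : Type*} : Consecution V → Prop
  | sf (φ ψ ξ : Fm V) : PAbRule (∅, (φ ⟶ₗ ψ) ⟶ₗ ((ψ ⟶ₗ ξ) ⟶ₗ (φ ⟶ₗ ξ)))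
  | e (φ ψ ξ : Fm V) : PAbRule (∅, (φ ⟶ₗ (ψ ⟶ₗ ξ)) ⟶ₗ (ψ ⟶ₗ (φ ⟶ₗ ξ)))
  | ident (φ : Fm V) : PAbRule (∅, φ ⟶ₗ φ)
  | abe (φ ψ : Fm V) : PAbRule (∅, ((φ ⟶ₗ ψ) ⟶ₗ ψ) ⟶ₗ φ)
  | ub₁ (φ ψ : Fm V) : PAbRule (∅, φ ⟶ₗ (φ ∨ₗ ψ))
  | ub₂ (φ ψ : Fm V) : PAbRule (∅, ψ ⟶ₗ (φ ∨ₗ ψ))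
  | lb₁ (φ ψ : Fm V) : PAbRule (∅, (φ ∧ₗ ψ) ⟶ₗ φ)
  | lb₂ (φ ψ : Fm V) : PAbRule (∅, (φ ∧ₗ ψ) ⟶ₗ ψ)
  | sup (φ ψ χ : Fm V) : PAbRule (∅, ((φ ⟶ₗ χ) ∧ₗ (ψ ⟶ₗ χ)) ⟶ₗ ((φ ∨ₗ ψ) ⟶ₗ χ))
  | inf (φ ψ χ : Fm V) : PAbRule (∅, ((χ ⟶ₗ φ) ∧ₗ (χ ⟶ₗ ψ)) ⟶ₗ (χ ⟶ₗ (φ ∧ₗ ψ)))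
  | push (φ : Fm V) : PAbRule (∅, φ ⟶ₗ (Fm.t ⟶ₗ φ))
  | pop (φ : Fm V) : PAbRule (∅, (Fm.t ⟶ₗ φ) ⟶ₗ φ)
  | res₁ (φ ψ ξ : Fm V) : PAbRule (∅, (φ ⟶ₗ (ψ ⟶ₗ ξ)) ⟶ₗ ((φ &ₗ ψ) ⟶ₗ ξ))
  | res₂ (φ ψ ξ : Fm V) : PAbRule (∅, ((φ &ₗ ψ) ⟶ₗ ξ) ⟶ₗ (φ ⟶ₗ (ψ ⟶ₗ ξ)))
  | mp (φ ψ : Fm V) : PAbRule ({φ, φ ⟶ₗ ψ}, ψ)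
  | adj (φ ψ : Fm V) : PAbRule ({φ, ψ}, φ ∧ₗ ψ)

/-- The presentation of pointed Abelian logic. -/
def pAbSystem (V : Type*) : Set (Consecution V) := {c | PAbRule c}

/-- Pointed Abelian logic extended by all instances of the rule `f ∨ φ ⊢ φ`:
Łukasiewicz unbound logic. -/
def Lu (V : Type*) : Set (Consecution V) :=
  logicOf (pAbSystem V ∪ {c | ∃ φ : Fm V, c = ({Fm.f ∨ₗ φ}, φ)})

/-- Pointed Abelian logic extended by all instances of the rule `-f ∨ φ ⊢ φ`. -/
def LuStar (V : Type*) : Set (Consecution V) :=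
  logicOf (pAbSystem V ∪ {c | ∃ φ : Fm V, c = ({Fm.neg Fm.f ∨ₗ φ}, φ)})

/-- The translation that replaces `f` by `-f` and commutes with everything else. -/
def tau {V : Type*} : Fm V → Fm V
  | Fm.var x => Fm.var x
  | Fm.imp φ ψ => Fm.imp (tau φ) (tau ψ)
  | Fm.conj φ ψ => Fm.conj (tau φ) (tau ψ)
  | Fm.or φ ψ => Fm.or (tau φ) (tau ψ)
  | Fm.and φ ψ => Fm.and (tau φ) (tau ψ)
  | Fm.t => Fm.t
  | Fm.f => Fm.neg Fm.f

end PointedAbelian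

namespace PointedAbelian

variable {V : Type*}

/-! The translation is an involution up to provable equivalence: it sends `f` to `--f` after two
rounds, and pointed Abelian logic proves `--f` equivalent to `f` and every connective monotone or
antitone in each argument. It also interchanges the two extra rules, up to this equivalence, so
derivations translate in both directions (`translate`). For each converse, translate back with the
other direction and erase the double translation (`of_tau_tau`). -/

/-- The rules of pointed Abelian logic are closed under the translation. -/
theorem PAbRule.tau_image {c : Consecution V} (h : PAbRule c) :
    PAbRule (tau '' c.1, tau c.2) := by
  -- No schema mentions `f`, so the image of an instance is an instance of the same schema.
  cases h <;> simp only [Set.image_empty, Set.image_pair, tau] <;> constructor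

namespace TreeProvable

variable {A : Set (Consecution V)} {Γ Δ : Set (Fm V)} {φ ψ χ φ' ψ' : Fm V}

theorem cut (h : TreeProvable A Δ φ) (hΓ : ∀ δ ∈ Δ, TreeProvable A Γ δ) :
    TreeProvable A Γ φ := by
  induction h with
  | premise φ hφ => exact hΓ φ hφ
  | rule Δ' φ hr _ ih => exact .rule Δ' φ hr ih

theorem of_pAb_axiom (hA : pAbSystem V ⊆ A) (h : PAbRule (∅, φ)) : TreeProvable A Γ φ :=
  .rule ∅ φ (hA h) (by simp)

theorem mp (hA : pAbSystem V ⊆ A) (h₁ : TreeProvable A Γ (φ ⟶ₗ ψ))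
    (h₂ : TreeProvable A Γ φ) : TreeProvable A Γ ψ :=
  .rule {φ, φ ⟶ₗ ψ} ψ (hA (PAbRule.mp φ ψ)) (by
    rintro δ (rfl | rfl)
    exacts [h₂, h₁])

theorem adj (hA : pAbSystem V ⊆ A) (h₁ : TreeProvable A Γ φ)
    (h₂ : TreeProvable A Γ ψ) : TreeProvable A Γ (φ ∧ₗ ψ) :=
  .rule {φ, ψ} (φ ∧ₗ ψ) (hA (PAbRule.adj φ ψ)) (by
    rintro δ (rfl | rfl)
    exacts [h₁, h₂])

theorem imp_refl (hA : pAbSystem V ⊆ A) : TreeProvable A Γ (φ ⟶ₗ φ) :=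
  of_pAb_axiom hA (.ident φ)

theorem imp_trans (hA : pAbSystem V ⊆ A) (h₁ : TreeProvable A Γ (φ ⟶ₗ ψ))
    (h₂ : TreeProvable A Γ (ψ ⟶ₗ χ)) : TreeProvable A Γ (φ ⟶ₗ χ) :=
  mp hA (mp hA (of_pAb_axiom hA (.sf φ ψ χ)) h₁) h₂

theorem exchange (hA : pAbSystem V ⊆ A) (h : TreeProvable A Γ (φ ⟶ₗ (ψ ⟶ₗ χ))) :
    TreeProvable A Γ (ψ ⟶ₗ (φ ⟶ₗ χ)) :=
  mp hA (of_pAb_axiom hA (.e φ ψ χ)) h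

theorem imp_neg_neg (hA : pAbSystem V ⊆ A) : TreeProvable A Γ (φ ⟶ₗ φ.neg.neg) :=
  exchange hA (imp_refl hA)

/-- This is the Abelian axiom with `t` as its second formula. -/
theorem neg_neg_imp (hA : pAbSystem V ⊆ A) : TreeProvable A Γ (φ.neg.neg ⟶ₗ φ) :=
  of_pAb_axiom hA (.abe φ Fm.t)

theorem imp_mono (hA : pAbSystem V ⊆ A) (h₁ : TreeProvable A Γ (φ' ⟶ₗ φ))
    (h₂ : TreeProvable A Γ (ψ ⟶ₗ ψ')) :
    TreeProvable A Γ ((φ ⟶ₗ ψ) ⟶ₗ (φ' ⟶ₗ ψ')) :=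
  imp_trans hA (mp hA (of_pAb_axiom hA (.sf φ' φ ψ)) h₁)
    (mp hA (exchange hA (of_pAb_axiom hA (.sf φ' ψ ψ'))) h₂)

theorem conj_mono (hA : pAbSystem V ⊆ A) (h₁ : TreeProvable A Γ (φ ⟶ₗ φ'))
    (h₂ : TreeProvable A Γ (ψ ⟶ₗ ψ')) :
    TreeProvable A Γ ((φ &ₗ ψ) ⟶ₗ (φ' &ₗ ψ')) :=
  -- By residuation the goal is `φ → (ψ → φ' & ψ')`; start from `φ' → (ψ' → φ' & ψ')` and weaken
  -- each antecedent in turn, using exchange.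
  mp hA (of_pAb_axiom hA (.res₁ φ ψ _)) <|
    exchange hA <| imp_trans hA h₂ <| exchange hA <| imp_trans hA h₁ <|
      mp hA (of_pAb_axiom hA (.res₂ φ' ψ' _)) (imp_refl hA)

theorem or_mono (hA : pAbSystem V ⊆ A) (h₁ : TreeProvable A Γ (φ ⟶ₗ φ'))
    (h₂ : TreeProvable A Γ (ψ ⟶ₗ ψ')) :
    TreeProvable A Γ ((φ ∨ₗ ψ) ⟶ₗ (φ' ∨ₗ ψ')) :=
  mp hA (of_pAb_axiom hA (.sup φ ψ _)) <|
    adj hA (imp_trans hA h₁ (of_pAb_axiom hA (.ub₁ φ' ψ')))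
      (imp_trans hA h₂ (of_pAb_axiom hA (.ub₂ φ' ψ')))

theorem and_mono (hA : pAbSystem V ⊆ A) (h₁ : TreeProvable A Γ (φ ⟶ₗ φ'))
    (h₂ : TreeProvable A Γ (ψ ⟶ₗ ψ')) :
    TreeProvable A Γ ((φ ∧ₗ ψ) ⟶ₗ (φ' ∧ₗ ψ')) :=
  mp hA (of_pAb_axiom hA (.inf φ' ψ' _)) <|
    adj hA (imp_trans hA (of_pAb_axiom hA (.lb₁ φ ψ)) h₁)
      (imp_trans hA (of_pAb_axiom hA (.lb₂ φ ψ)) h₂)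

/-- Translating twice yields an equivalent formula. -/
theorem tau_tau_equiv (hA : pAbSystem V ⊆ A) (φ : Fm V) :
    TreeProvable A Γ (tau (tau φ) ⟶ₗ φ) ∧ TreeProvable A Γ (φ ⟶ₗ tau (tau φ)) := by
  induction φ with
  | var x => exact ⟨imp_refl hA, imp_refl hA⟩
  | t => exact ⟨imp_refl hA, imp_refl hA⟩
  | f => exact ⟨neg_neg_imp hA, imp_neg_neg hA⟩
  -- Implication is antitone on the left, so each direction needs the opposite one for `φ`.
  | imp φ ψ h₁ h₂ => exact ⟨imp_mono hA h₁.2 h₂.1, imp_mono hA h₁.1 h₂.2⟩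
  | conj φ ψ h₁ h₂ => exact ⟨conj_mono hA h₁.1 h₂.1, conj_mono hA h₁.2 h₂.2⟩
  | or φ ψ h₁ h₂ => exact ⟨or_mono hA h₁.1 h₂.1, or_mono hA h₁.2 h₂.2⟩
  | and φ ψ h₁ h₂ => exact ⟨and_mono hA h₁.1 h₂.1, and_mono hA h₁.2 h₂.2⟩

theorem of_tau_tau (hA : pAbSystem V ⊆ A)
    (h : TreeProvable A (tau '' (tau '' Γ)) (tau (tau φ))) : TreeProvable A Γ φ := by
  refine mp hA (tau_tau_equiv hA φ).1 (h.cut ?_)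
  rintro _ ⟨_, ⟨γ, hγ, rfl⟩, rfl⟩
  exact mp hA (tau_tau_equiv hA γ).2 (.premise γ hγ)

/-- Translation of derivations between two extensions of pointed Abelian logic, provided that the
translations of the additional rules of the first are derivable in the second. -/
theorem translate {R S : Set (Consecution V)}
    (hR : ∀ c ∈ R, TreeProvable (pAbSystem V ∪ S) (tau '' c.1) (tau c.2))
    (h : TreeProvable (pAbSystem V ∪ R) Γ φ) :
    TreeProvable (pAbSystem V ∪ S) (tau '' Γ) (tau φ) := by
  induction h with
  | premise φ hφ => exact .premise _ ⟨φ, hφ, rfl⟩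
  | rule Δ φ hr _ ih =>
    have hΔ : ∀ δ ∈ tau '' Δ, TreeProvable (pAbSystem V ∪ S) (tau '' Γ) δ := by
      rintro _ ⟨δ, hδ, rfl⟩
      exact ih δ hδ
    rcases hr with hr | hr
    · exact .rule _ _ (Or.inl (PAbRule.tau_image hr)) hΔ
    -- The translated extra rule need only be derivable, so its derivation is grafted in by cut.
    · exact (hR _ hr).cut hΔ

end TreeProvable

theorem tau_mem_luStar {Γ : Set (Fm V)} {φ : Fm V} (h : (Γ, φ) ∈ Lu V) :
    (tau '' Γ, tau φ) ∈ LuStar V := by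
  refine TreeProvable.translate ?_ h
  rintro _ ⟨ψ, rfl⟩
  rw [Set.image_singleton]
  exact .rule _ _ (Or.inr ⟨tau ψ, rfl⟩) fun δ hδ => .premise δ hδ

theorem tau_mem_lu {Γ : Set (Fm V)} {φ : Fm V} (h : (Γ, φ) ∈ LuStar V) :
    (tau '' Γ, tau φ) ∈ Lu V := by
  refine TreeProvable.translate ?_ h
  rintro _ ⟨ψ, rfl⟩
  rw [Set.image_singleton]
  -- The translated premise is `--f ∨ tau ψ`; double negation elimination turns it into the `f ∨ tau
  -- ψ` that this rule requires.
  refine .rule _ _ (Or.inr ⟨tau ψ, rfl⟩) ?_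
  rintro _ rfl
  have hA := Set.subset_union_left (s := pAbSystem V)
    (t := {c | ∃ φ : Fm V, c = ({Fm.f ∨ₗ φ}, φ)})
  exact .mp hA (.or_mono hA (.neg_neg_imp hA) (.imp_refl hA)) (.premise _ rfl)

end PointedAbelian

theorem theoremt (V : Type*) (Γ : Set (PointedAbelian.Fm V)) (φ : PointedAbelian.Fm V) :
    ((Γ, φ) ∈ PointedAbelian.Lu V ↔
      (PointedAbelian.tau '' Γ, PointedAbelian.tau φ) ∈ PointedAbelian.LuStar V) ∧
    ((Γ, φ) ∈ PointedAbelian.LuStar V ↔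
      (PointedAbelian.tau '' Γ, PointedAbelian.tau φ) ∈ PointedAbelian.Lu V) :=
  ⟨⟨PointedAbelian.tau_mem_luStar, fun h =>
      PointedAbelian.TreeProvable.of_tau_tau Set.subset_union_left (PointedAbelian.tau_mem_lu h)⟩,
    ⟨PointedAbelian.tau_mem_lu, fun h =>
      PointedAbelian.TreeProvable.of_tau_tau Set.subset_union_left
        (PointedAbelian.tau_mem_luStar h)⟩⟩
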